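/- Let $k\ge 2$ be an integer and let $T=T^k$ be the vertex set of the infinite rooted $k$-ary tree, equipped with the tree metric $d$ and the counting measure, $|A|$ being the number of elements of $A\subset T$. For $x\in T$ and $r\in\mathbb{N}\cup\{0\}$ put $B(x,r)=\{y\in T: d(x,y)\le r\}$ and $S(x,r)=\{y\in T: d(x,y)=r\}$, and for $f:T\to\mathbb{R}$ let \[ Mf(x)=\sup_{r\in\mathbb{N}\cup\{0\}}\frac{1}{|B(x,r)|}\sum_{y\in B(x,r)}|f(y)|,\qquad \|f\|_{L^q(w)}=\Big(\sum_{x\in T}|f(x)|^q\,w(x)\Big)^{1/q}. \] Let $T_0$ consist of the root and let $T_{j}$ be the set of children of the vertices in $T_{j-1}$ for $j\ge 1$. Let $\delta\in\left(\tfrac12,1\right)$ and \[ w(x)=\sum_{j=0}^{\infty}\frac{1}{k^{\delta j}}\,\chi_{T_j}(x). \] Then for every $q\in(1,\infty)$ there is a constant $C<\infty$, depending only on $q$ and $\delta$ (and not on $k$), such that \[ \|Mf\|_{L^q(w)}\le C\,\|f\|_{L^q(w)}\qquad\text{for all } f:T\to\mathbb{R}. \] On the other hand, for every $k\ge2$ and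 every $p\in(1,\infty)$, \[ \sup_{x\in T,\ r>0}\left(\frac{1}{|S(x,r)|}\sum_{y\in S(x,r)}w(y)\right)\left(\frac{1}{|S(x,r)|}\sum_{y\in S(x,r)}w(y)^{-\frac{1}{p-1}}\right)^{p-1}=\infty \] and \[ \sup_{x\in T,\ r\ge0}\left(\frac{1}{|B(x,r)|}\sum_{y\in B(x,r)}w(y)\right)\left(\frac{1}{|B(x,r)|}\sum_{y\in B(x,r)}w(y)^{-\frac{1}{p-1}}\right)^{p-1}=\infty, \] the suprema being over integers $r$. In particular, for every $p\in(1,\infty)$, $M$ is bounded on $L^p(w)$ although $w$ does not satisfy the $A_p$ condition. -/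

import Mathlib

open MeasureTheory
open scoped ENNReal NNReal

/-- Vertices of the infinite rooted `k`-ary tree: finite words over the alphabet `Fin k`.
The root is the empty word and the `k` children of a word `x` are the words `a :: x`. -/
def KTree (k : ℕ) : Type := List (Fin k)

namespace KTree

/-- The root. -/
def root {k : ℕ} : KTree k := ([] : List (Fin k))

/-- The `a`-th child of the vertex `x`. -/
def child {k : ℕ} (a : Fin k) (x : KTree k) : KTree k := List.cons a x

/-- The infinite rooted `k`-ary tree as a graph: the edges join each vertex to its children. -/
def graph (k : ℕ) : SimpleGraph (KTree k) where
  Adj x y := (∃ a, y = child a x) ∨ ∃ a, x = child a y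
  symm := ⟨fun _ _ h => h.symm⟩
  loopless := ⟨fun x h => by
    rcases h with ⟨a, h⟩ | ⟨a, h⟩ <;> exact List.cons_ne_self a x h.symm⟩

/-- Any two vertices are joined by a path, so that the graph distance never takes a junk value. -/
theorem graph_connected (k : ℕ) : (graph k).Connected := by
  have key : ∀ x : KTree k, (graph k).Reachable root x := by
    intro x
    induction x with
    | nil => exact SimpleGraph.Reachable.refl _
    | cons a y ih =>
      exact ih.trans (SimpleGraph.Adj.reachable (G := graph k) (Or.inl ⟨a, rfl⟩))
  have : Nonempty (KTree k) := ⟨root⟩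
  exact ⟨fun x y => (key x).symm.trans (key y)⟩

/-- The graph is a tree: any two vertices are joined by a unique path. -/
theorem graph_isTree (k : ℕ) : (graph k).IsTree := by
  refine ⟨graph_connected k, ?_⟩
  have key : ∀ (a : Fin k) (x : KTree k),
      ¬ ((graph k).deleteEdges {s(x, child a x)}).Reachable x (child a x) := by
    intro a x h
    have inv : ∀ u v : KTree k, ((graph k).deleteEdges {s(x, child a x)}).Reachable u v →
        (¬ List.IsSuffix (α := Fin k) (child a x) u) →
        ¬ List.IsSuffix (α := Fin k) (child a x) v := by
      rintro u v ⟨w⟩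
      induction w with
      | nil => exact id
      | cons hadj _ ih =>
        rename_i u v _ _
        refine fun hu => ih fun hv => ?_
        rw [SimpleGraph.deleteEdges_adj] at hadj
        obtain ⟨⟨b, rfl⟩ | ⟨b, rfl⟩, hne⟩ := hadj
        · rcases List.suffix_cons_iff.1 hv with h1 | h1
          · have h2 : a = b ∧ x = u := List.cons.inj h1
            exact hne (by rw [h2.1, h2.2]; rfl)
          · exact hu h1
        · exact hu (hv.trans (List.suffix_cons b v))
    refine inv x (child a x) h (fun hs => ?_) (List.suffix_refl _)
    exact Nat.not_succ_le_self _ hs.length_le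
  rw [SimpleGraph.isAcyclic_iff_forall_adj_isBridge]
  intro x y hxy
  rw [SimpleGraph.isBridge_iff]
  rcases hxy with ⟨a, rfl⟩ | ⟨a, rfl⟩
  · exact key a x
  · intro h
    rw [Sym2.eq_swap] at h
    exact key a y h.symm

/-- Every set of vertices is measurable. -/
instance {k : ℕ} : MeasurableSpace (KTree k) := ⊤

variable {k : ℕ}

/-- The generations: `level 0` consists of the root, and `level (j + 1)` of the children of the
vertices of `level j`. -/
def level : ℕ → Set (KTree k)
  | 0 => {root}
  | j + 1 => {y | ∃ x ∈ level j, ∃ a, y = child a x}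

/-- The ball of centre `x` and radius `r` in the tree metric. -/
def ball (x : KTree k) (r : ℕ) : Set (KTree k) := {y | (graph k).dist x y ≤ r}

/-- The sphere of centre `x` and radius `r` in the tree metric. -/
def sphere (x : KTree k) (r : ℕ) : Set (KTree k) := {y | (graph k).dist x y = r}

/-- The centred Hardy–Littlewood maximal function
`M f (x) = sup_r |B(x, r)|⁻¹ ∑_{y ∈ B(x, r)} |f y|`, with respect to the counting measure. -/
noncomputable def maximal (f : KTree k → ℝ) (x : KTree k) : ℝ≥0∞ :=
  ⨆ r : ℕ, ⨍⁻ y in ball x r, ‖f y‖ₑ ∂Measure.count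

/-- The measure `w dμ`, where `μ` is the counting measure. -/
noncomputable def weighted (w : KTree k → ℝ) : Measure (KTree k) :=
  Measure.count.withDensity fun x => ENNReal.ofReal (w x)

/-- The `A_p` quantity of the weight `w` on a set `S` of vertices: the average of `w` over `S`
times the `(p - 1)`-th power of the average of `w ^ (-1 / (p - 1))` over `S`. -/
noncomputable def apQuantity (w : KTree k → ℝ) (p : ℝ) (S : Set (KTree k)) : ℝ≥0∞ :=
  (⨍⁻ y in S, ENNReal.ofReal (w y) ∂Measure.count) *
    (⨍⁻ y in S, ENNReal.ofReal (w y ^ (-(1 / (p - 1)))) ∂Measure.count) ^ (p - 1)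

/-- The weight `w = ∑_j k ^ (-δ j) χ_{T_j}`, where `T_j` is the `j`-th generation. -/
noncomputable def powerWeight (k : ℕ) (δ : ℝ) (x : KTree k) : ℝ :=
  ∑' j : ℕ, (level j).indicator (fun _ => 1 / (k : ℝ) ^ (δ * (j : ℝ))) x

end KTree

namespace KTree

/-! Boundedness needs only `0 < δ < 1`. A ball containing `y` contains the ball about the same
centre `x` of radius `d(x,y)`, hence at least `k ^ d(x,y)` vertices, so with Jensen `(Mf)^q` is at
most the kernel `k ^ (-d(x,y))` applied to `|f|^q` (`maximal_rpow_le`). Summing against `w` leaves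
the Schur-type bound `∑ₓ w(x) k ^ (-d(x,y)) ≤ C w(y)` (`tsum_rpow_depth_dist_le`): going `i` steps
up and `m` down from `y` contributes at most `w(y) k ^ (-(1-δ)i) k ^ (-δm)`, and both geometric
series are largest at `k = 2`.

`A_p` fails at a centre of depth `r` and radius `r`: the root has weight 1, while `k ^ r`
descendants have depth `2r`. This forces growth like `k ^ ((2δ-1)r)` (`rpow_le_apQuantity`),
unbounded because `δ > 1/2`. -/

/-- The number of edges between a vertex and the root. -/
def depth {k : ℕ} (x : KTree k) : ℕ := List.length (α := Fin k) x

/-- The descendant of `x` reached by following the word `v` downwards. -/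
def graft {k : ℕ} (v : List (Fin k)) (x : KTree k) : KTree k := List.append v x

/-- The `i`-th ancestor of `x` (the root if `i` exceeds the depth of `x`). -/
def ancestor {k : ℕ} (i : ℕ) (x : KTree k) : KTree k := List.drop (α := Fin k) i x

instance {k : ℕ} : DiscreteMeasurableSpace (KTree k) := ⟨fun _ => trivial⟩

/-! ### Paths, distances and ball sizes in the tree -/

section Tree

variable {k : ℕ}

@[simp] theorem depth_root : depth (root : KTree k) = 0 := rfl

@[simp] theorem depth_child (a : Fin k) (x : KTree k) : depth (child a x) = depth x + 1 := rfl

@[simp] theorem depth_graft (v : List (Fin k)) (x : KTree k) :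
    depth (graft v x) = v.length + depth x := List.length_append

@[simp] theorem depth_ancestor (i : ℕ) (x : KTree k) : depth (ancestor i x) = depth x - i :=
  List.length_drop

theorem graft_injective (x : KTree k) : Function.Injective fun v => graft v x :=
  fun _ _ h => List.append_cancel_right h

theorem mem_level_iff (j : ℕ) (x : KTree k) : x ∈ level j ↔ depth x = j := by
  induction j generalizing x with
  | zero => exact List.length_eq_zero_iff.symm
  | succ j ih =>
    constructor
    · rintro ⟨y, hy, a, rfl⟩
      rw [depth_child, (ih y).1 hy]
    · intro h
      cases x with
      | nil => cases h
      | cons a y => exact ⟨y, (ih y).2 (Nat.succ.inj h), a, rfl⟩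

theorem dist_graft_le (v : List (Fin k)) (x : KTree k) :
    (graph k).dist x (graft v x) ≤ v.length := by
  induction v with
  | nil => exact (SimpleGraph.dist_self (G := graph k)).le
  | cons a v ih =>
    have h1 : (graph k).Adj (graft v x) (graft (a :: v) x) := Or.inl ⟨a, rfl⟩
    have h2 := (graph_connected k).dist_triangle (u := x) (v := graft v x) (w := graft (a :: v) x)
    rw [SimpleGraph.dist_eq_one_iff_adj.2 h1] at h2
    simpa using h2.trans (Nat.succ_le_succ ih)

theorem exists_graft_ancestor_of_walk {x y : KTree k} (p : (graph k).Walk x y) :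
    ∃ (i : ℕ) (v : List (Fin k)), y = graft v (ancestor i x) ∧ i + v.length ≤ p.length := by
  induction p with
  | nil => exact ⟨0, [], rfl, le_rfl⟩
  | @cons x x' y hadj p ih =>
    obtain ⟨i, v, rfl, hl⟩ := ih
    rw [SimpleGraph.Walk.length_cons]
    obtain ⟨a, rfl⟩ | ⟨a, rfl⟩ := hadj
    · cases i with
      | zero =>
        -- The newest letter stands first, so a step down taken before `v` is appended at the end.
        refine ⟨0, v ++ [a], ?_, by simp; omega⟩
        exact (List.append_assoc v [a] x).symm
      | succ i => exact ⟨i, v, rfl, by omega⟩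
    · exact ⟨i + 1, v, rfl, by omega⟩

/-- Every vertex `y` is reached from `x` by going up and then down, in at most `dist x y` steps. -/
theorem exists_graft_ancestor (x y : KTree k) :
    ∃ (i : ℕ) (v : List (Fin k)),
      y = graft v (ancestor i x) ∧ i + v.length ≤ (graph k).dist x y := by
  obtain ⟨p, hp⟩ := (graph_connected k).exists_walk_length_eq_dist x y
  exact hp ▸ exists_graft_ancestor_of_walk p

theorem depth_le_depth_add_dist (x y : KTree k) : depth y ≤ depth x + (graph k).dist x y := by
  obtain ⟨i, v, hy, hl⟩ := exists_graft_ancestor x y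
  have h := congrArg depth hy
  simp only [depth_graft, depth_ancestor] at h
  omega

theorem dist_graft (v : List (Fin k)) (x : KTree k) :
    (graph k).dist x (graft v x) = v.length := by
  refine (dist_graft_le v x).antisymm ?_
  have := depth_le_depth_add_dist x (graft v x)
  rw [depth_graft] at this
  omega

theorem dist_root (x : KTree k) : (graph k).dist x root = depth x := by
  have h := dist_graft x root
  rw [SimpleGraph.dist_comm] at h
  rwa [show graft x root = x from List.append_nil x] at h

theorem tsum_list_length (h : ℕ → ℝ≥0∞) :
    ∑' v : List (Fin k), h v.length = ∑' m : ℕ, (k : ℝ≥0∞) ^ m * h m := by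
  rw [← (Equiv.sigmaFiberEquiv (List.length (α := Fin k))).tsum_eq, ENNReal.tsum_sigma']
  refine tsum_congr fun m => ?_
  have : ∀ v : {v : List (Fin k) // v.length = m},
      h ((Equiv.sigmaFiberEquiv (List.length (α := Fin k))) ⟨m, v⟩).length = h m := by
    rintro ⟨v, rfl⟩
    rfl
  simp_rw [this]
  have hc : ENat.card {v : List (Fin k) // v.length = m} = ((k ^ m : ℕ) : ℕ∞) := by
    have := card_vector (α := Fin k) m
    rw [Fintype.card_fin] at this
    rw [← this]
    exact ENat.card_eq_coe_fintype_card (α := List.Vector (Fin k) m)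
  rw [ENNReal.tsum_const, hc]
  simp

theorem count_descendants (x : KTree k) (r : ℕ) :
    Measure.count ((fun v => graft v x) '' {v : List (Fin k) | v.length = r}) =
      (k : ℝ≥0∞) ^ r := by
  rw [Measure.count_apply .of_discrete, (graft_injective x).encard_image]
  have hc : ({v : List (Fin k) | v.length = r}).encard = ((k ^ r : ℕ) : ℕ∞) := by
    have := card_vector (α := Fin k) r
    rw [Fintype.card_fin] at this
    rw [← this]
    exact ENat.card_eq_coe_fintype_card (α := List.Vector (Fin k) r)
  rw [hc]
  simp

theorem pow_le_count_ball (x : KTree k) (r : ℕ) :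
    (k : ℝ≥0∞) ^ r ≤ Measure.count (ball x r) := by
  rw [← count_descendants x r]
  refine measure_mono ?_
  rintro _ ⟨v, rfl, rfl⟩
  exact dist_graft_le v x

/-- Count the words of length `m ≤ r - i` below each ancestor `i ≤ r`. Each of the two geometric
sums costs at most one factor `k`, which is harmless since it does not depend on `r`. -/
theorem count_ball_le (hk : 2 ≤ k) (x : KTree k) (r : ℕ) :
    Measure.count (ball x r) ≤ (k : ℝ≥0∞) ^ (r + 2) := by
  classical
  let D : Finset (KTree k) := (Finset.range (r + 1)).biUnion fun i =>
    (Finset.range (r + 1 - i)).biUnion fun m =>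
      Finset.univ.image fun u : Fin m → Fin k => graft (List.ofFn u) (ancestor i x)
  have hsub : ball x r ⊆ (D : Set (KTree k)) := by
    intro y hy
    obtain ⟨i, v, rfl, hl⟩ := exists_graft_ancestor x y
    have hr : i + v.length ≤ r := hl.trans hy
    simp only [D, Finset.coe_biUnion, Set.mem_iUnion, Finset.coe_image, Finset.coe_univ,
      Set.image_univ, Set.mem_range, Finset.coe_range, Set.mem_Iio]
    exact ⟨i, by omega, v.length, by omega, v.get, by rw [List.ofFn_get]⟩
  have hcard : D.card ≤ k ^ (r + 2) := by
    calc D.card ≤ ∑ i ∈ Finset.range (r + 1), k ^ (r + 1 - i) := by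
          refine Finset.card_biUnion_le.trans (Finset.sum_le_sum fun i _ => ?_)
          refine Finset.card_biUnion_le.trans ?_
          refine (Finset.sum_le_sum (g := fun m => k ^ m) fun m _ => ?_).trans
            (Nat.geomSum_lt hk fun m hm => Finset.mem_range.1 hm).le
          refine Finset.card_image_le.trans ?_
          simp
      _ = ∑ i ∈ Finset.range (r + 1), k ^ (i + 1) := by
          rw [← Finset.sum_range_reflect]
          refine Finset.sum_congr rfl fun i hi => ?_
          have := Finset.mem_range.1 hi
          congr 1
          omega
      _ = k * ∑ i ∈ Finset.range (r + 1), k ^ i := by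
          rw [Finset.mul_sum]
          exact Finset.sum_congr rfl fun i _ => pow_succ' k i
      _ ≤ k * k ^ (r + 1) :=
          Nat.mul_le_mul_left k (Nat.geomSum_lt hk fun m hm => Finset.mem_range.1 hm).le
      _ = k ^ (r + 2) := (pow_succ' k (r + 1)).symm
  calc Measure.count (ball x r) ≤ Measure.count (D : Set (KTree k)) := measure_mono hsub
    _ = D.card := Measure.count_apply_finset D
    _ ≤ ((k ^ (r + 2) : ℕ) : ℝ≥0∞) := by exact_mod_cast hcard
    _ = (k : ℝ≥0∞) ^ (r + 2) := by push_cast; rfl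

theorem powerWeight_eq (δ : ℝ) (x : KTree k) :
    powerWeight k δ x = (k : ℝ) ^ (-(δ * depth x)) := by
  unfold powerWeight
  rw [tsum_eq_single (depth x)]
  · rw [Set.indicator_of_mem ((mem_level_iff _ _).2 rfl), Real.rpow_neg (Nat.cast_nonneg k),
      one_div]
  · intro j hj
    exact Set.indicator_of_notMem (fun h => hj ((mem_level_iff _ _).1 h).symm) _

theorem ofReal_powerWeight (hk : 2 ≤ k) (δ : ℝ) (x : KTree k) :
    ENNReal.ofReal (powerWeight k δ x) = (k : ℝ≥0∞) ^ (-(δ * depth x)) := by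
  rw [powerWeight_eq, ← ENNReal.ofReal_rpow_of_pos (by positivity), ENNReal.ofReal_natCast]

end Tree

end KTree
namespace KTree
-- Boundedness of the maximal function
section Maximal

/-- Jensen, as the inclusion of `L^q` in `L^1` for the normalised measure. Its mass is at most 1
even when `μ` is zero or infinite, and this suffices. -/
theorem laverage_rpow_le {α : Type*} [MeasurableSpace α] (μ : Measure α) {q : ℝ} (hq : 1 ≤ q)
    {g : α → ℝ≥0∞} (hg : AEMeasurable g μ) :
    (⨍⁻ y, g y ∂μ) ^ q ≤ ⨍⁻ y, g y ^ q ∂μ := by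
  have hq0 : 0 < q := one_pos.trans_le hq
  set ν := (μ Set.univ)⁻¹ • μ with hν
  have hν1 : ν Set.univ ≤ 1 := by
    rw [hν, Measure.smul_apply, smul_eq_mul]
    exact ENNReal.inv_mul_le_one _
  have h := eLpNorm'_le_eLpNorm'_mul_rpow_measure_univ (f := g) (μ := ν) one_pos hq
    (hg.smul_measure _).aestronglyMeasurable
  simp only [eLpNorm', enorm_eq_self, ENNReal.rpow_one, div_one] at h
  have h1 : ν Set.univ ^ (1 - 1 / q) ≤ 1 := by
    refine ENNReal.rpow_le_one hν1 (sub_nonneg.2 ?_)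
    rw [div_le_one hq0]
    exact hq
  rw [← ENNReal.le_rpow_inv_iff hq0, ← one_div]
  exact h.trans ((mul_le_mul_right h1 _).trans_eq (mul_one _))

variable {k : ℕ}

theorem laverage_ball_le (g : KTree k → ℝ≥0∞) (x : KTree k) (r : ℕ) :
    ⨍⁻ y in ball x r, g y ∂Measure.count ≤
      ∑' y, g y * (k : ℝ≥0∞) ^ (-((graph k).dist x y : ℝ)) := by
  rw [setLAverage_eq, ENNReal.div_eq_inv_mul, ← lintegral_const_mul _ .of_discrete,
    ← lintegral_count]
  refine (setLIntegral_mono' .of_discrete fun y hy => ?_).trans (setLIntegral_le_lintegral _ _)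
  rw [mul_comm, ENNReal.rpow_neg, ENNReal.rpow_natCast]
  refine mul_le_mul_right (ENNReal.inv_le_inv.2 ?_) _
  refine (pow_le_count_ball x _).trans (measure_mono fun z hz => ?_)
  exact le_trans (show (graph k).dist x z ≤ _ from hz) hy

theorem maximal_rpow_le {q : ℝ} (hq : 1 ≤ q) (f : KTree k → ℝ) (x : KTree k) :
    maximal f x ^ q ≤ ∑' y, ‖f y‖ₑ ^ q * (k : ℝ≥0∞) ^ (-((graph k).dist x y : ℝ)) := by
  have hq0 : 0 < q := one_pos.trans_le hq
  rw [← ENNReal.le_rpow_inv_iff hq0]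
  refine iSup_le fun r => ?_
  rw [ENNReal.le_rpow_inv_iff hq0]
  exact (laverage_rpow_le _ hq (Measurable.of_discrete.aemeasurable)).trans
    (laverage_ball_le _ x r)

theorem tsum_two_rpow_lt_top {a : ℝ} (ha : 0 < a) :
    ∑' m : ℕ, (2 : ℝ≥0∞) ^ (-(a * m)) < ⊤ := by
  have : ∀ m : ℕ, (2 : ℝ≥0∞) ^ (-(a * m)) = ((2 : ℝ≥0∞) ^ (-a)) ^ m := fun m => by
    rw [← neg_mul, ENNReal.rpow_mul, ENNReal.rpow_natCast]
  simp_rw [this]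
  rw [ENNReal.tsum_geometric, ENNReal.inv_lt_top, tsub_pos_iff_lt]
  exact ENNReal.rpow_lt_one_of_one_lt_of_neg (by norm_num) (by linarith)

theorem rpow_neg_le_two_rpow_neg (hk : 2 ≤ k) {a : ℝ} (ha : 0 ≤ a) :
    (k : ℝ≥0∞) ^ (-a) ≤ 2 ^ (-a) := by
  rw [ENNReal.rpow_neg, ENNReal.rpow_neg]
  exact ENNReal.inv_le_inv.2 (ENNReal.rpow_le_rpow (by exact_mod_cast hk) ha)

theorem tsum_rpow_depth_dist_le (hk : 2 ≤ k) {δ : ℝ} (h0 : 0 ≤ δ) (h1 : δ ≤ 1) (y : KTree k) :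
    ∑' x : KTree k, (k : ℝ≥0∞) ^ (-(δ * depth x)) * (k : ℝ≥0∞) ^ (-((graph k).dist x y : ℝ)) ≤
      (∑' i : ℕ, (2 : ℝ≥0∞) ^ (-((1 - δ) * i))) * (∑' m : ℕ, (2 : ℝ≥0∞) ^ (-(δ * m))) *
        (k : ℝ≥0∞) ^ (-(δ * depth y)) := by
  have hk0 : (k : ℝ≥0∞) ≠ 0 := by simp; omega
  have hkt : (k : ℝ≥0∞) ≠ ⊤ := ENNReal.natCast_ne_top k
  have hk1 : (1 : ℝ≥0∞) ≤ k := by exact_mod_cast (by omega : 1 ≤ k)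
  -- Each `x` is encoded by one up-then-down route from `y`. The code determines `x`, so the sum
  -- over vertices is at most the sum over all codes.
  choose i v hx hl using fun x : KTree k => exists_graft_ancestor y x
  have hinj : Function.Injective fun x : KTree k => (i x, v x) := by
    intro x x' h
    obtain ⟨hi, hv⟩ := Prod.mk.inj h
    rw [hx x, hx x', hi, hv]
  let G : ℕ × List (Fin k) → ℝ≥0∞ := fun c =>
    (k : ℝ≥0∞) ^ (-(δ * (c.2.length + depth y - c.1)) - (c.1 + c.2.length))
  calc
    _ ≤ ∑' x : KTree k, G (i x, v x) := by
      refine ENNReal.tsum_le_tsum fun x => ?_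
      rw [← ENNReal.rpow_add _ _ hk0 hkt]
      refine ENNReal.rpow_le_rpow_of_exponent_le hk1 ?_
      have e1 : (i x : ℝ) + (v x).length ≤ (graph k).dist x y := by
        rw [SimpleGraph.dist_comm]
        exact_mod_cast hl x
      -- Only an inequality: a code may climb past the root, where the ancestor's depth stays 0.
      have e2 : ((v x).length : ℝ) + depth y - i x ≤ depth x := by
        have h := congrArg depth (hx x)
        simp only [depth_graft, depth_ancestor] at h
        rw [sub_le_iff_le_add]
        exact_mod_cast (by omega : (v x).length + depth y ≤ depth x + i x)
      have := mul_le_mul_of_nonneg_left e2 h0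
      linarith
    _ ≤ ∑' c, G c := ENNReal.tsum_comp_le_tsum_of_injective hinj G
    _ = ∑' (i : ℕ) (m : ℕ), (k : ℝ≥0∞) ^ (-((1 - δ) * i)) *
          ((k : ℝ≥0∞) ^ (-(δ * m)) * (k : ℝ≥0∞) ^ (-(δ * depth y))) := by
      rw [ENNReal.tsum_prod']
      refine tsum_congr fun i => ?_
      rw [tsum_list_length fun m =>
        (k : ℝ≥0∞) ^ (-(δ * ((m : ℝ) + depth y - i)) - ((i : ℝ) + (m : ℝ)))]
      refine tsum_congr fun m => ?_
      rw [← ENNReal.rpow_natCast, ← ENNReal.rpow_add _ _ hk0 hkt, ← ENNReal.rpow_add _ _ hk0 hkt,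
        ← ENNReal.rpow_add _ _ hk0 hkt]
      congr 1
      ring
    -- Replacing `k` by 2 in the two decaying factors makes the constant independent of `k`.
    _ ≤ ∑' (i : ℕ) (m : ℕ), (2 : ℝ≥0∞) ^ (-((1 - δ) * i)) *
          ((2 : ℝ≥0∞) ^ (-(δ * m)) * (k : ℝ≥0∞) ^ (-(δ * depth y))) := by
      refine ENNReal.tsum_le_tsum fun i => ENNReal.tsum_le_tsum fun m => ?_
      gcongr ?_ * (?_ * _)
      · exact rpow_neg_le_two_rpow_neg hk (mul_nonneg (by linarith) (Nat.cast_nonneg i))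
      · exact rpow_neg_le_two_rpow_neg hk (mul_nonneg h0 (Nat.cast_nonneg m))
    _ = _ := by
      simp_rw [ENNReal.tsum_mul_left, ENNReal.tsum_mul_right]
      ring

theorem lintegral_weighted (w : KTree k → ℝ) (g : KTree k → ℝ≥0∞) :
    ∫⁻ x, g x ∂(weighted w) = ∑' x, ENNReal.ofReal (w x) * g x := by
  rw [weighted, lintegral_withDensity_eq_lintegral_mul _ .of_discrete .of_discrete,
    lintegral_count]
  rfl

theorem lintegral_maximal_rpow_le (hk : 2 ≤ k) {δ : ℝ} (h0 : 0 ≤ δ) (h1 : δ ≤ 1) {q : ℝ}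
    (hq : 1 ≤ q) (f : KTree k → ℝ) :
    ∫⁻ x, maximal f x ^ q ∂(weighted (powerWeight k δ)) ≤
      (∑' i : ℕ, (2 : ℝ≥0∞) ^ (-((1 - δ) * i))) * (∑' m : ℕ, (2 : ℝ≥0∞) ^ (-(δ * m))) *
        ∫⁻ x, ‖f x‖ₑ ^ q ∂(weighted (powerWeight k δ)) := by
  simp_rw [lintegral_weighted, ofReal_powerWeight hk]
  calc
    _ ≤ ∑' x : KTree k, ∑' y, ‖f y‖ₑ ^ q * ((k : ℝ≥0∞) ^ (-(δ * depth x)) *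
          (k : ℝ≥0∞) ^ (-((graph k).dist x y : ℝ))) := by
      refine ENNReal.tsum_le_tsum fun x => ?_
      refine (mul_le_mul_right (maximal_rpow_le hq f x) _).trans_eq ?_
      rw [← ENNReal.tsum_mul_left]
      exact tsum_congr fun y => mul_left_comm _ _ _
    _ ≤ ∑' y : KTree k, ‖f y‖ₑ ^ q *
          ((∑' i : ℕ, (2 : ℝ≥0∞) ^ (-((1 - δ) * i))) * (∑' m : ℕ, (2 : ℝ≥0∞) ^ (-(δ * m))) *
            (k : ℝ≥0∞) ^ (-(δ * depth y))) := by
      rw [ENNReal.tsum_comm]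
      refine ENNReal.tsum_le_tsum fun y => ?_
      rw [ENNReal.tsum_mul_left]
      exact mul_le_mul_right (tsum_rpow_depth_dist_le hk h0 h1 y) _
    _ = _ := by
      refine Eq.trans (tsum_congr fun y => ?_) ENNReal.tsum_mul_left
      ring

/-- The maximal function is bounded on `L^q` of a power weight, uniformly in the arity. -/
theorem exists_eLpNorm_maximal_le {δ : ℝ} (h0 : 0 < δ) (h1 : δ < 1) {q : ℝ} (hq : 1 ≤ q) :
    ∃ C : ℝ≥0, ∀ k : ℕ, 2 ≤ k → ∀ f : KTree k → ℝ,
      eLpNorm (maximal f) (ENNReal.ofReal q) (weighted (powerWeight k δ)) ≤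
        C * eLpNorm f (ENNReal.ofReal q) (weighted (powerWeight k δ)) := by
  have hq0 : 0 < q := one_pos.trans_le hq
  set D : ℝ≥0∞ :=
    (∑' i : ℕ, (2 : ℝ≥0∞) ^ (-((1 - δ) * i))) * (∑' m : ℕ, (2 : ℝ≥0∞) ^ (-(δ * m))) with hD
  have hDt : D < ⊤ :=
    ENNReal.mul_lt_top (tsum_two_rpow_lt_top (sub_pos.2 h1)) (tsum_two_rpow_lt_top h0)
  refine ⟨(D ^ (1 / q)).toNNReal, fun k hk f => ?_⟩
  rw [ENNReal.coe_toNNReal (ENNReal.rpow_lt_top_of_nonneg (by positivity) hDt.ne).ne]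
  have hp0 : ENNReal.ofReal q ≠ 0 := (ENNReal.ofReal_pos.2 hq0).ne'
  rw [eLpNorm_eq_lintegral_rpow_enorm_toReal hp0 ENNReal.ofReal_ne_top,
    eLpNorm_eq_lintegral_rpow_enorm_toReal hp0 ENNReal.ofReal_ne_top,
    ENNReal.toReal_ofReal hq0.le, ← ENNReal.mul_rpow_of_nonneg _ _ (by positivity)]
  exact ENNReal.rpow_le_rpow (lintegral_maximal_rpow_le hk h0.le h1.le hq f) (by positivity)

end Maximal

/-! ### Failure of the `A_p` condition -/

section Ap

variable {k : ℕ}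

/-- Stated for any `S` between the two extreme parts and the ball, so that it covers spheres and
balls at once. Each average keeps one extreme part and uses `|S| ≤ k ^ (r + 2)`; the loss `k ^ 2`
enters with total power `1 + (p - 1)`, whence `2 * p`. -/
theorem rpow_le_apQuantity (hk : 2 ≤ k) (δ : ℝ) {p : ℝ} (hp : 1 < p) {x : KTree k} {r : ℕ}
    (hx : depth x = r) {S : Set (KTree k)} (hS : S ⊆ ball x r) (hroot : root ∈ S)
    (hdesc : (fun v => graft v x) '' {v : List (Fin k) | v.length = r} ⊆ S) :
    (k : ℝ≥0∞) ^ ((2 * δ - 1) * r - 2 * p) ≤ apQuantity (powerWeight k δ) p S := by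
  have hk0 : (k : ℝ≥0∞) ≠ 0 := by simp; omega
  have hkt : (k : ℝ≥0∞) ≠ ⊤ := ENNReal.natCast_ne_top k
  have hkR : (0 : ℝ) < k := by exact_mod_cast (by omega : 0 < k)
  have hp1 : 0 < p - 1 := sub_pos.2 hp
  have hc : (k : ℝ≥0∞) ^ (-((r : ℝ) + 2)) ≤ (Measure.count S)⁻¹ := by
    rw [ENNReal.rpow_neg, ENNReal.inv_le_inv]
    refine ((measure_mono hS).trans (count_ball_le hk x r)).trans_eq ?_
    rw [← ENNReal.rpow_natCast]
    push_cast
    rfl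
  have havg : ∀ (g : KTree k → ℝ≥0∞) (A : Set (KTree k)) (c : ℝ≥0∞), A ⊆ S → (∀ y ∈ A, g y = c) →
      (k : ℝ≥0∞) ^ (-((r : ℝ) + 2)) * (c * Measure.count A) ≤ ⨍⁻ y in S, g y ∂Measure.count := by
    intro g A c hA hg
    rw [setLAverage_eq, ENNReal.div_eq_inv_mul]
    refine mul_le_mul' hc ?_
    rw [← setLIntegral_const, setLIntegral_congr_fun .of_discrete fun y hy => (hg y hy).symm]
    exact lintegral_mono_set hA
  have h1 := havg (fun y => ENNReal.ofReal (powerWeight k δ y)) {root} 1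
    (Set.singleton_subset_iff.2 hroot) (by
      rintro y rfl
      rw [ofReal_powerWeight hk]
      simp)
  -- The descendants have depth `2r`, hence weight `k ^ (-2δr)`.
  have h2 := havg (fun y => ENNReal.ofReal (powerWeight k δ y ^ (-(1 / (p - 1))))) _
    ((k : ℝ≥0∞) ^ (2 * δ * r / (p - 1))) hdesc (by
      rintro _ ⟨v, hv, rfl⟩
      have hv' : v.length = r := hv
      rw [powerWeight_eq, depth_graft, hv', hx, ← Real.rpow_mul hkR.le,
        ← ENNReal.ofReal_rpow_of_pos hkR, ENNReal.ofReal_natCast]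
      congr 1
      push_cast
      field_simp
      ring)
  rw [count_descendants, ← ENNReal.rpow_natCast, ← ENNReal.rpow_add _ _ hk0 hkt,
    ← ENNReal.rpow_add _ _ hk0 hkt] at h2
  rw [Measure.count_singleton, mul_one, mul_one] at h1
  refine le_trans (le_of_eq ?_) (mul_le_mul' h1 (ENNReal.rpow_le_rpow h2 hp1.le))
  rw [← ENNReal.rpow_mul, ← ENNReal.rpow_add _ _ hk0 hkt]
  congr 1
  field_simp
  ring

theorem exists_depth_eq (hk : 2 ≤ k) (r : ℕ) : ∃ x : KTree k, depth x = r :=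
  ⟨List.replicate r (⟨0, by omega⟩ : Fin k), List.length_replicate⟩

theorem exists_lt_natCast_rpow (hk : 2 ≤ k) {a : ℝ} (ha : 0 < a) (b : ℝ) (M : ℝ≥0) :
    ∃ r : ℕ, 0 < r ∧ (M : ℝ≥0∞) < (k : ℝ≥0∞) ^ (a * r - b) := by
  have hk1 : (1 : ℝ) < k := by exact_mod_cast (by omega : 1 < k)
  have h : Filter.Tendsto (fun r : ℕ => (k : ℝ) ^ (a * r - b)) Filter.atTop Filter.atTop := by
    refine (tendsto_rpow_atTop_of_base_gt_one _ hk1).comp ?_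
    exact Filter.tendsto_atTop_add_const_right _ (-b)
      (tendsto_natCast_atTop_atTop.const_mul_atTop ha)
  obtain ⟨r, hr, hr0⟩ := ((h.eventually_gt_atTop (M : ℝ)).and (Filter.eventually_gt_atTop 0)).exists
  refine ⟨r, hr0, ?_⟩
  rw [← ENNReal.ofReal_natCast k, ENNReal.ofReal_rpow_of_pos (by linarith),
    ← ENNReal.ofReal_coe_nnreal]
  exact (ENNReal.ofReal_lt_ofReal_iff_of_nonneg M.2).2 hr

theorem iSup_apQuantity_sphere (hk : 2 ≤ k) {δ p : ℝ} (hδ : 1 / 2 < δ) (hp : 1 < p) :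
    (⨆ (x : KTree k) (r : ℕ) (_ : 0 < r),
      apQuantity (powerWeight k δ) p (sphere x r)) = ⊤ := by
  refine ENNReal.eq_top_of_forall_nnreal_le fun M => ?_
  obtain ⟨r, hr, hM⟩ := exists_lt_natCast_rpow hk (a := 2 * δ - 1) (by linarith) (2 * p) M
  obtain ⟨x, hx⟩ := exists_depth_eq hk r
  refine (hM.le.trans (rpow_le_apQuantity hk δ hp hx (S := sphere x r) (fun _ h => le_of_eq h)
    ((dist_root x).trans hx) ?_)).trans
    (le_iSup_of_le x (le_iSup_of_le r (le_iSup_of_le hr le_rfl)))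
  rintro _ ⟨v, rfl, rfl⟩
  exact dist_graft v x

theorem iSup_apQuantity_ball (hk : 2 ≤ k) {δ p : ℝ} (hδ : 1 / 2 < δ) (hp : 1 < p) :
    (⨆ (x : KTree k) (r : ℕ), apQuantity (powerWeight k δ) p (ball x r)) = ⊤ := by
  refine ENNReal.eq_top_of_forall_nnreal_le fun M => ?_
  obtain ⟨r, -, hM⟩ := exists_lt_natCast_rpow hk (a := 2 * δ - 1) (by linarith) (2 * p) M
  obtain ⟨x, hx⟩ := exists_depth_eq hk r
  refine (hM.le.trans (rpow_le_apQuantity hk δ hp hx (S := ball x r) subset_rfl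
    ((dist_root x).trans hx).le ?_)).trans (le_iSup_of_le x (le_iSup_of_le r le_rfl))
  rintro _ ⟨v, rfl, rfl⟩
  exact dist_graft_le v x

end Ap

end KTree

theorem proposition3p1 (δ : ℝ) (hδ : δ ∈ Set.Ioo (1 / 2 : ℝ) 1) :
    (∀ q : ℝ, 1 < q → ∃ C : ℝ≥0, ∀ k : ℕ, 2 ≤ k → ∀ f : KTree k → ℝ,
      eLpNorm (KTree.maximal f) (ENNReal.ofReal q) (KTree.weighted (KTree.powerWeight k δ)) ≤
        C * eLpNorm f (ENNReal.ofReal q) (KTree.weighted (KTree.powerWeight k δ))) ∧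
    (∀ k : ℕ, 2 ≤ k → ∀ p : ℝ, 1 < p →
      (⨆ (x : KTree k) (r : ℕ) (_ : 0 < r),
        KTree.apQuantity (KTree.powerWeight k δ) p (KTree.sphere x r)) = ⊤ ∧
      (⨆ (x : KTree k) (r : ℕ),
        KTree.apQuantity (KTree.powerWeight k δ) p (KTree.ball x r)) = ⊤) :=
  ⟨fun _ hq => KTree.exists_eLpNorm_maximal_le (by linarith [hδ.1]) hδ.2 hq.le,
    fun _ hk _ hp => ⟨KTree.iSup_apQuantity_sphere hk hδ.1 hp,
      KTree.iSup_apQuantity_ball hk hδ.1 hp⟩⟩
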